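/- A product vector is a nonzero vector $f\otimes g$. A gUPB (general unextendible product basis) in $\mathbb C^n\otimes\mathbb C^m$ is a set of $k$ product vectors $\{\phi_i\otimes\psi_i\}_{i=1}^k$, $0<k<nm$, such that no product vector is orthogonal to all of them. A PPT state on $\mathbb C^3\otimes\mathbb C^3$ is a nonzero, not necessarily normalized, positive semidefinite matrix $\rho$ whose partial transpose is positive semidefinite. Let $\phi_1,\dots,\phi_5,\psi_1,\dots,\psi_5\in\mathbb C^3$ be such that $\{\phi_i\otimes\psi_i\}_{i=1}^5$ is a gUPB (with five elements) in $\mathbb C^3\otimes\mathbb C^3$. Write $|x\,y\,z|$ for the determinant of the $3\times3$ matrix with columns $x,y,z$ and put $$s_1=-\frac{|\phi_1\phi_2\phi_4|\,|\phi_1\phi_3\phi_5|}{|\phi_1\phi_2\phi_5|\,|\phi_1\phi_3\phi_4|},\qquad s_2=-\frac{|\phi_1\phi_2\phi_3|\,|\phi_2\phi_4\phi_5|}{|\phi_1\phi_2\phi_4|\,|\phi_2\phi_3\phi_5|},$$ $$s_3=-\frac{|\psi_1\psi_3\psi_2|\,|\psi_1\psi_5\psi_4|}{|\psi_1\psi_3\psi_4|\,|\psi_1\psi_5\psi_2|},\qquad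 s_4=-\frac{|\psi_1\psi_3\psi_5|\,|\psi_3\psi_2\psi_4|}{|\psi_1\psi_3\psi_2|\,|\psi_3\psi_5\psi_4|}.$$ For a permutation $\kappa$ of $\{1,\dots,5\}$ let $s_k^\kappa$ be the value of $s_k$ obtained with $\phi_{\kappa(i)},\psi_{\kappa(i)}$ in place of $\phi_i,\psi_i$. A complex number is called positive if it is real and $>0$. Then: (1) There is a PPT state $\rho$ on $\mathbb C^3\otimes\mathbb C^3$ of rank $4$ with $\phi_i\otimes\psi_i\in\ker\rho$ for $i=1,\dots,5$ if and only if there is a permutation $\kappa$ such that $s_1^\kappa,s_2^\kappa,s_3^\kappa,s_4^\kappa$ are all positive. (2) Such a permutation exists if and only if one exists among the following twelve, where $abcde$ stands for $1\mapsto a,\dots,5\mapsto e$: $\sigma_1=12345$, $\sigma_2=13245$, $\sigma_3=21345$, $\sigma_4=23145$, $\sigma_5=31245$, $\sigma_6=32145$, $\sigma_7=12435$, $\sigma_8=14235$, $\sigma_9=21435$, $\sigma_{10}=24135$, $\sigma_{11}=13425$, $\sigma_{12}=14325$. (3) There are $p,q,r,s\in\mathbb C$ and $A,B\in SL(3,\mathbb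 C)$ such that $A\phi_1,\dots,A\phi_5$ are nonzero multiples of $e_1,e_2,e_3,(1,1,1),(1,p,q)$, respectively, and $B\psi_1,\dots,B\psi_5$ are nonzero multiples of $e_1,e_2,e_3,(1,1,1),(1,r,s)$, respectively. For all such $p,q,r,s$ the values $(s_1^{\sigma_j},s_2^{\sigma_j},s_3^{\sigma_j},s_4^{\sigma_j})$ are - $\sigma_1$: $-\frac pq,\ q-1,\ \frac{r-s}{s},\ \frac{r}{1-r}$ - $\sigma_2$: $-\frac qp,\ p-1,\ \frac{s-r}{r},\ \frac{s}{1-s}$ - $\sigma_3$: $-\frac1q,\ \frac{q-p}{p},\ \frac{1-s}{s},\ \frac1{r-1}$ - $\sigma_4$: $-q,\ \frac{1-p}{p},\ s-1,\ \frac{s}{r-s}$ - $\sigma_5$: $-\frac1p,\ \frac{p-q}{q},\ \frac{1-r}{r},\ \frac1{s-1}$ - $\sigma_6$: $-p,\ \frac{1-q}{q},\ r-1,\ \frac{r}{s-r}$ - $\sigma_7$: $\frac{p-q}{q},\ \frac1{q-1},\ -\frac rs,\ \frac{s-r}{r-1}$ - $\sigma_8$: $\frac{q}{p-q},\ \frac{1-p}{q-1},\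 \frac{r}{s-r},\ -s$ - $\sigma_9$: $-\frac{q-1}{q},\ \frac{p}{q-p},\ -\frac1s,\ \frac{1-s}{r-1}$ - $\sigma_{10}$: $\frac{q}{1-q},\ \frac{p-1}{q-p},\ \frac1{s-1},\ -\frac sr$ - $\sigma_{11}$: $\frac{q-p}{p},\ \frac1{p-1},\ -\frac sr,\ \frac{r-s}{s-1}$ - $\sigma_{12}$: $\frac{p}{q-p},\ \frac{1-q}{p-1},\ \frac{s}{r-s},\ -r$ -/

import Mathlib

open scoped ComplexOrder

noncomputable section

namespace GUPB

/-- The product vector `x ⊗ y`, where `ℂⁿ ⊗ ℂᵐ` is modelled as the Hilbert space `ℂ^(n × m)`;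
its `(i, j)` coordinate is `x i * y j`. -/
def prodVec {n m : ℕ} (x : EuclideanSpace ℂ (Fin n)) (y : EuclideanSpace ℂ (Fin m)) :
    EuclideanSpace ℂ (Fin n × Fin m) :=
  WithLp.toLp 2 fun ij => x ij.1 * y ij.2

/-- `{φ i ⊗ ψ i}`, `i = 1, …, k`, is a general unextendible product basis of `ℂⁿ ⊗ ℂᵐ`:
a set of `k` product vectors, `0 < k < n m`, such that the orthogonal complement of their
linear span contains no product vector. Product vectors are nonzero by convention. -/
structure IsGUPB {n m k : ℕ} (φ : Fin k → EuclideanSpace ℂ (Fin n))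
    (ψ : Fin k → EuclideanSpace ℂ (Fin m)) : Prop where
  card_pos : 0 < k
  card_lt : k < n * m
  left_ne_zero : ∀ i, φ i ≠ 0
  right_ne_zero : ∀ i, ψ i ≠ 0
  injective : Function.Injective fun i => prodVec (φ i) (ψ i)
  unextendible : ∀ (f : EuclideanSpace ℂ (Fin n)) (g : EuclideanSpace ℂ (Fin m)),
    f ≠ 0 → g ≠ 0 →
      prodVec f g ∉ (Submodule.span ℂ (Set.range fun i => prodVec (φ i) (ψ i)))ᗮ

/-- Partial transpose `ρ^{T₁}` with respect to the first subsystem. -/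
def partialTranspose {n m : ℕ} (ρ : Matrix (Fin n × Fin m) (Fin n × Fin m) ℂ) :
    Matrix (Fin n × Fin m) (Fin n × Fin m) ℂ :=
  Matrix.of fun a b => ρ (b.1, a.2) (a.1, b.2)

/-- A (not necessarily normalized) PPT state: a nonzero positive semidefinite matrix whose
partial transpose is positive semidefinite as well. -/
structure IsPPTState {n m : ℕ} (ρ : Matrix (Fin n × Fin m) (Fin n × Fin m) ℂ) : Prop where
  ne_zero : ρ ≠ 0
  posSemidef : ρ.PosSemidef
  posSemidef_partialTranspose : (partialTranspose ρ).PosSemidef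

/-- The determinant `|x y z|` of the `3 × 3` matrix with columns `x`, `y`, `z`. -/
def det3 (x y z : EuclideanSpace ℂ (Fin 3)) : ℂ :=
  (Matrix.of fun i j : Fin 3 => (![x, y, z] j) i).det

/-- The invariants `s₁, s₂, s₃, s₄`, as entries `0, 1, 2, 3`. The five vectors are numbered from
`0` to `4`. -/
def invariants (φ ψ : Fin 5 → EuclideanSpace ℂ (Fin 3)) : Fin 4 → ℂ :=
  ![-((det3 (φ 0) (φ 1) (φ 3) * det3 (φ 0) (φ 2) (φ 4)) /
      (det3 (φ 0) (φ 1) (φ 4) * det3 (φ 0) (φ 2) (φ 3))),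
    -((det3 (φ 0) (φ 1) (φ 2) * det3 (φ 1) (φ 3) (φ 4)) /
      (det3 (φ 0) (φ 1) (φ 3) * det3 (φ 1) (φ 2) (φ 4))),
    -((det3 (ψ 0) (ψ 2) (ψ 1) * det3 (ψ 0) (ψ 4) (ψ 3)) /
      (det3 (ψ 0) (ψ 2) (ψ 3) * det3 (ψ 0) (ψ 4) (ψ 1))),
    -((det3 (ψ 0) (ψ 2) (ψ 4) * det3 (ψ 2) (ψ 1) (ψ 3)) /
      (det3 (ψ 0) (ψ 2) (ψ 1) * det3 (ψ 2) (ψ 4) (ψ 3)))]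

/-- The invariants of the family with `φ (κ i) ⊗ ψ (κ i)` in place of `φ i ⊗ ψ i`. -/
def permInvariants (φ ψ : Fin 5 → EuclideanSpace ℂ (Fin 3)) (κ : Equiv.Perm (Fin 5)) :
    Fin 4 → ℂ :=
  invariants (fun i => φ (κ i)) (fun i => ψ (κ i))

/-- The lower rows of the twelve listed permutations, in two-row notation, with `1, …, 5`
written as `0, …, 4`. -/
def permRow : Fin 12 → Fin 5 → Fin 5 :=
  ![![0, 1, 2, 3, 4], ![0, 2, 1, 3, 4], ![1, 0, 2, 3, 4],
    ![1, 2, 0, 3, 4], ![2, 0, 1, 3, 4], ![2, 1, 0, 3, 4],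
    ![0, 1, 3, 2, 4], ![0, 3, 1, 2, 4], ![1, 0, 3, 2, 4],
    ![1, 3, 0, 2, 4], ![0, 2, 3, 1, 4], ![0, 3, 2, 1, 4]]

theorem permRow_bijective (j : Fin 12) : Function.Bijective (permRow j) := by
  revert j; decide

/-- The twelve listed permutations `σ₁, …, σ₁₂`, numbered from `0` to `11`. -/
def perm (j : Fin 12) : Equiv.Perm (Fin 5) :=
  Equiv.ofBijective (permRow j) (permRow_bijective j)

/-- The five columns `e₁, e₂, e₃, (1,1,1), (1,p,q)`. -/
def stdVec (p q : ℂ) : Fin 5 → EuclideanSpace ℂ (Fin 3) :=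
  ![!₂[1, 0, 0], !₂[0, 1, 0], !₂[0, 0, 1], !₂[1, 1, 1], !₂[1, p, q]]

/-- The vectors `x i` become the vectors `y i` under a transformation from `SL(3, ℂ)`, up to
individual nonzero scalar factors. -/
def PSLEquivalent (x y : Fin 5 → EuclideanSpace ℂ (Fin 3)) : Prop :=
  ∃ (A : Matrix.SpecialLinearGroup (Fin 3) ℂ) (c : Fin 5 → ℂ),
    ∀ i, c i ≠ 0 ∧ Matrix.toEuclideanLin (A : Matrix (Fin 3) (Fin 3) ℂ) (x i) = c i • y i

/-- The product vectors `φ i ⊗ ψ i` are locally equivalent to the normal form with parameters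
`p, q` on the first factor and `r, s` on the second. -/
def HasNormalForm (φ ψ : Fin 5 → EuclideanSpace ℂ (Fin 3)) (p q r s : ℂ) : Prop :=
  PSLEquivalent φ (stdVec p q) ∧ PSLEquivalent ψ (stdVec r s)

/-- The table of expressions for `s₁, s₂, s₃, s₄` (columns) that correspond to the twelve listed
permutations (rows), in the parameters of the normal form. -/
def invariantTable (p q r s : ℂ) : Fin 12 → Fin 4 → ℂ :=
  ![![-(p / q), q - 1, (r - s) / s, r / (1 - r)],
    ![-(q / p), p - 1, (s - r) / r, s / (1 - s)],
    ![-(1 / q), (q - p) / p, (1 - s) / s, 1 / (r - 1)],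
    ![-q, (1 - p) / p, s - 1, s / (r - s)],
    ![-(1 / p), (p - q) / q, (1 - r) / r, 1 / (s - 1)],
    ![-p, (1 - q) / q, r - 1, r / (s - r)],
    ![(p - q) / q, 1 / (q - 1), -(r / s), (s - r) / (r - 1)],
    ![q / (p - q), (1 - p) / (q - 1), r / (s - r), -s],
    ![-((q - 1) / q), p / (q - p), -(1 / s), (1 - s) / (r - 1)],
    ![q / (1 - q), (p - 1) / (q - p), 1 / (s - 1), -(s / r)],
    ![(q - p) / p, 1 / (p - 1), -(s / r), (r - s) / (s - 1)],
    ![p / (q - p), (1 - q) / (p - 1), s / (r - s), -r]]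

end GUPB

end

/-!
By unextendibility any three of the `φ i`, and any three of the `ψ i`, are linearly independent:
otherwise a vector orthogonal to three of the `φ i`, tensored with a vector orthogonal to the
remaining two `ψ i`, would extend the family. Five such vectors of `ℂ³` have the normal form
`e₁, e₂, e₃, (1,1,1), (1,p,q)` by Cramer's rule. Since the invariants are homogeneous of degree
zero in each vector, they are functions of the parameters of the normal form, which gives the table.
PPT states are carried along by local transformations, so everything reduces to the normal form.

Let `ρ` be a PPT state whose kernel contains the five product vectors in normal form. The kernel of
its partial transpose contains the partially conjugated product vectors. The vectors `eᵢ ⊗ eᵢ` then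
leave nonzero only the entries of `ρ` on the diagonal and along the edges of a hexagon whose
vertices are the six off-diagonal index pairs. The remaining two vectors make `ρ` the Laplacian of
this hexagon with real weights, make `p, q, r, s` real, and make the weights inversely proportional
to the differences `hexDiff` of the vector `(1,p,q) ⊗ (1,r,s)` along the edges
(`exists_weights_of_isPPTState`). Positivity of `ρ` allows at most one negative weight, and the
differences add up to zero, so exactly one of them has a sign different from the other five
(`exists_sign_pattern`). This confines the parameters to twelve regions, one for each row of the
table, and the row is positive there (`exists_signRegion`, `invariantTable_pos_of_signRegion`).

Conversely, positive invariants for a permutation `κ` mean that the parameters of the relabelled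
family lie in the first of these regions. The hexagon Laplacian with weights `-1 / hexDiff` is a real
combination of projections onto real product vectors, hence equal to its own partial transpose; it
is positive semidefinite by the Cauchy–Schwarz inequality, has rank four, and annihilates the five
product vectors (`hasPPTState_stdVec`). Hence any permutation with positive invariants yields a
state, and a state yields one of the twelve permutations.
-/

noncomputable section

namespace GUPB

open scoped Kronecker Matrix

/-! ### Determinants and general position -/

theorem det3_eq (x y z : EuclideanSpace ℂ (Fin 3)) :
    det3 x y z = x 0 * y 1 * z 2 - x 0 * z 1 * y 2 - y 0 * x 1 * z 2 + y 0 * z 1 * x 2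
      + z 0 * x 1 * y 2 - z 0 * y 1 * x 2 := by
  simp [det3, Matrix.det_fin_three]

theorem det3_toEuclideanLin (A : Matrix (Fin 3) (Fin 3) ℂ) (x y z : EuclideanSpace ℂ (Fin 3)) :
    det3 (Matrix.toEuclideanLin A x) (Matrix.toEuclideanLin A y) (Matrix.toEuclideanLin A z) =
      A.det * det3 x y z := by
  unfold det3
  rw [← Matrix.det_mul]
  congr 1
  ext i j
  fin_cases j <;> simp [Matrix.mul_apply, Matrix.mulVec, dotProduct, Matrix.toLpLin_apply]

theorem det3_smul (a b c : ℂ) (x y z : EuclideanSpace ℂ (Fin 3)) :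
    det3 (a • x) (b • y) (c • z) = a * b * c * det3 x y z := by
  simp only [det3_eq, PiLp.smul_apply, smul_eq_mul]
  ring

theorem exists_inner_eq_zero_of_det3_eq_zero {x y z : EuclideanSpace ℂ (Fin 3)}
    (h : det3 x y z = 0) :
    ∃ f : EuclideanSpace ℂ (Fin 3), f ≠ 0 ∧ inner ℂ x f = 0 ∧ inner ℂ y f = 0 ∧
      inner ℂ z f = 0 := by
  obtain ⟨v, hv, hv0⟩ := Matrix.exists_vecMul_eq_zero_iff.2 h
  have key : ∀ j : Fin 3, inner ℂ (![x, y, z] j) (WithLp.toLp 2 (star v)) = 0 := by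
    intro j
    have := congrArg star (congrFun hv0 j)
    simpa [Matrix.vecMul, dotProduct, PiLp.inner_apply, Fin.sum_univ_three] using this
  refine ⟨WithLp.toLp 2 (star v), ?_, key 0, key 1, key 2⟩
  intro h0
  exact hv (by simpa using h0)

theorem inner_prodVec {n m : ℕ} (a f : EuclideanSpace ℂ (Fin n)) (b g : EuclideanSpace ℂ (Fin m)) :
    inner ℂ (prodVec a b) (prodVec f g) = inner ℂ a f * inner ℂ b g := by
  simp only [PiLp.inner_apply, prodVec, RCLike.inner_apply, map_mul, Fintype.sum_prod_type,
    Finset.sum_mul_sum]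
  exact Finset.sum_congr rfl fun i _ => Finset.sum_congr rfl fun j _ => by ring

/-- Any three of the five vectors are linearly independent. -/
def InGeneralPosition (x : Fin 5 → EuclideanSpace ℂ (Fin 3)) : Prop :=
  ∀ i j k, i ≠ j → i ≠ k → j ≠ k → det3 (x i) (x j) (x k) ≠ 0

theorem InGeneralPosition.comp_perm {x : Fin 5 → EuclideanSpace ℂ (Fin 3)}
    (hx : InGeneralPosition x) (κ : Equiv.Perm (Fin 5)) :
    InGeneralPosition fun i => x (κ i) :=
  fun _ _ _ hij hik hjk => hx _ _ _ (κ.injective.ne hij) (κ.injective.ne hik) (κ.injective.ne hjk)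

/-- A product vector `f ⊗ g` such that each `φ i ⊗ ψ i` is orthogonal to it in at least one
factor contradicts unextendibility. -/
theorem IsGUPB.exists_inner_ne_zero {φ ψ : Fin 5 → EuclideanSpace ℂ (Fin 3)} (h : IsGUPB φ ψ)
    {f g : EuclideanSpace ℂ (Fin 3)} (hf : f ≠ 0) (hg : g ≠ 0) :
    ∃ i, inner ℂ (φ i) f ≠ 0 ∧ inner ℂ (ψ i) g ≠ 0 := by
  by_contra! hc
  refine h.unextendible f g hf hg ?_
  rw [Submodule.mem_orthogonal]
  intro u hu
  induction hu using Submodule.span_induction with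
  | mem u hu =>
    obtain ⟨i, rfl⟩ := hu
    simp only [inner_prodVec, mul_eq_zero]
    exact or_iff_not_imp_left.2 (hc i)
  | zero => simp
  | add u v _ _ hu hv => simp [inner_add_left, hu, hv]
  | smul a u _ hu => simp [inner_smul_left, hu]

theorem exists_two_remaining : ∀ i j k : Fin 5, i ≠ j → i ≠ k → j ≠ k →
    ∃ l m : Fin 5, ∀ t, t = i ∨ t = j ∨ t = k ∨ t = l ∨ t = m := by
  decide

/-- If three vectors of one factor were dependent, a vector orthogonal to them, together with a
vector of the other factor orthogonal to the two remaining ones, would extend the gUPB. -/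
theorem IsGUPB.inGeneralPosition_left {φ ψ : Fin 5 → EuclideanSpace ℂ (Fin 3)} (h : IsGUPB φ ψ) :
    InGeneralPosition φ := by
  intro i j k hij hik hjk h0
  obtain ⟨l, m, hlm⟩ := exists_two_remaining i j k hij hik hjk
  obtain ⟨f, hf, h1, h2, h3⟩ := exists_inner_eq_zero_of_det3_eq_zero h0
  obtain ⟨g, hg, h4, h5, -⟩ := exists_inner_eq_zero_of_det3_eq_zero
    (x := ψ l) (y := ψ m) (z := ψ m) (by rw [det3_eq]; ring)
  obtain ⟨t, ht, ht'⟩ := h.exists_inner_ne_zero hf hg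
  rcases hlm t with rfl | rfl | rfl | rfl | rfl
  all_goals simp_all

theorem IsGUPB.inGeneralPosition_right {φ ψ : Fin 5 → EuclideanSpace ℂ (Fin 3)}
    (h : IsGUPB φ ψ) : InGeneralPosition ψ := by
  intro i j k hij hik hjk h0
  obtain ⟨l, m, hlm⟩ := exists_two_remaining i j k hij hik hjk
  obtain ⟨f, hf, h1, h2, h3⟩ := exists_inner_eq_zero_of_det3_eq_zero h0
  obtain ⟨g, hg, h4, h5, -⟩ := exists_inner_eq_zero_of_det3_eq_zero
    (x := φ l) (y := φ m) (z := φ m) (by rw [det3_eq]; ring)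
  obtain ⟨t, ht, ht'⟩ := h.exists_inner_ne_zero hg hf
  rcases hlm t with rfl | rfl | rfl | rfl | rfl
  all_goals simp_all

/-! ### Normal form of five vectors in general position -/

theorem pslEquivalent_of_det_ne_zero {x y : Fin 5 → EuclideanSpace ℂ (Fin 3)}
    (A : Matrix (Fin 3) (Fin 3) ℂ) (hA : A.det ≠ 0) (c : Fin 5 → ℂ)
    (h : ∀ i, c i ≠ 0 ∧ Matrix.toEuclideanLin A (x i) = c i • y i) : PSLEquivalent x y := by
  obtain ⟨d, hd⟩ := IsAlgClosed.exists_pow_nat_eq A.det (n := 3) (by norm_num)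
  have hd0 : d ≠ 0 := by
    rintro rfl
    exact hA (by simpa using hd.symm)
  refine ⟨⟨d⁻¹ • A, ?_⟩, fun i => d⁻¹ * c i, fun i => ⟨mul_ne_zero (inv_ne_zero hd0) (h i).1, ?_⟩⟩
  · rw [Matrix.det_smul, ← hd]
    simp [hd0]
  · simp [(h i).2, mul_smul]

theorem PSLEquivalent.symm {x y : Fin 5 → EuclideanSpace ℂ (Fin 3)} (h : PSLEquivalent x y) :
    PSLEquivalent y x := by
  obtain ⟨A, c, h⟩ := h
  refine ⟨A⁻¹, fun i => (c i)⁻¹, fun i => ⟨inv_ne_zero (h i).1, ?_⟩⟩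
  have h1 : y i = (c i)⁻¹ • Matrix.toEuclideanLin (A : Matrix (Fin 3) (Fin 3) ℂ) (x i) := by
    rw [(h i).2, smul_smul, inv_mul_cancel₀ (h i).1, one_smul]
  have h2 : ((A⁻¹ : Matrix.SpecialLinearGroup (Fin 3) ℂ) : Matrix (Fin 3) (Fin 3) ℂ)
      * (A : Matrix (Fin 3) (Fin 3) ℂ) = 1 := by
    rw [← Matrix.SpecialLinearGroup.coe_mul, inv_mul_cancel, Matrix.SpecialLinearGroup.coe_one]
  rw [h1, map_smul]
  congr 1
  simp only [Matrix.toLpLin_apply]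
  rw [Matrix.mulVec_mulVec, h2, Matrix.one_mulVec]

theorem PSLEquivalent.exists_det3_eq {x y : Fin 5 → EuclideanSpace ℂ (Fin 3)}
    (h : PSLEquivalent x y) : ∃ c : Fin 5 → ℂ, (∀ i, c i ≠ 0) ∧
      ∀ i j k, det3 (x i) (x j) (x k) = c i * c j * c k * det3 (y i) (y j) (y k) := by
  obtain ⟨A, c, h⟩ := h
  refine ⟨c, fun i => (h i).1, fun i j k => ?_⟩
  rw [← det3_smul, ← (h i).2, ← (h j).2, ← (h k).2, det3_toEuclideanLin, A.det_coe, one_mul]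

theorem PSLEquivalent.inGeneralPosition {x y : Fin 5 → EuclideanSpace ℂ (Fin 3)}
    (h : PSLEquivalent x y) (hx : InGeneralPosition x) : InGeneralPosition y := by
  obtain ⟨c, hc, h⟩ := h.exists_det3_eq
  intro i j k hij hik hjk h0
  exact hx i j k hij hik hjk (by rw [h, h0, mul_zero])

/-- By Cramer's rule, the coordinates of a vector with respect to the first three ones are
quotients of determinants; the coordinates are rescaled so that the fourth vector becomes
`(1, 1, 1)`. -/
theorem InGeneralPosition.exists_pslEquivalent_stdVec {x : Fin 5 → EuclideanSpace ℂ (Fin 3)}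
    (hx : InGeneralPosition x) : ∃ p q : ℂ, PSLEquivalent x (stdVec p q) := by
  have h012 := hx 0 1 2 (by decide) (by decide) (by decide)
  have h312 := hx 3 1 2 (by decide) (by decide) (by decide)
  have h032 := hx 0 3 2 (by decide) (by decide) (by decide)
  have h013 := hx 0 1 3 (by decide) (by decide) (by decide)
  have h412 := hx 4 1 2 (by decide) (by decide) (by decide)
  set B : Matrix (Fin 3) (Fin 3) ℂ := Matrix.of
    ![fun j => det3 (EuclideanSpace.single j 1) (x 1) (x 2) / det3 (x 3) (x 1) (x 2),
      fun j => det3 (x 0) (EuclideanSpace.single j 1) (x 2) / det3 (x 0) (x 3) (x 2),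
      fun j => det3 (x 0) (x 1) (EuclideanSpace.single j 1) / det3 (x 0) (x 1) (x 3)] with hB
  have e1 : ∀ u v, det3 u v v = 0 := fun u v => by rw [det3_eq]; ring
  have e2 : ∀ u v, det3 u v u = 0 := fun u v => by rw [det3_eq]; ring
  have e3 : ∀ u v, det3 u u v = 0 := fun u v => by rw [det3_eq]; ring
  have hBv : ∀ v : EuclideanSpace ℂ (Fin 3), Matrix.toEuclideanLin B v =
      !₂[det3 v (x 1) (x 2) / det3 (x 3) (x 1) (x 2),
        det3 (x 0) v (x 2) / det3 (x 0) (x 3) (x 2),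
        det3 (x 0) (x 1) v / det3 (x 0) (x 1) (x 3)] := by
    intro v
    ext i
    fin_cases i <;>
    · simp [hB, Matrix.toLpLin_apply, dotProduct, Fin.sum_univ_three, det3_eq]
      ring
  have hdet : B.det ≠ 0 := by
    have h1 := det3_toEuclideanLin B (x 0) (x 1) (x 2)
    intro h0
    rw [h0, zero_mul, hBv, hBv, hBv, det3_eq] at h1
    simp [e1, e2, e3, h012, h312, h032, h013] at h1
  refine ⟨(det3 (x 0) (x 4) (x 2) / det3 (x 0) (x 3) (x 2)) /
      (det3 (x 4) (x 1) (x 2) / det3 (x 3) (x 1) (x 2)),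
    (det3 (x 0) (x 1) (x 4) / det3 (x 0) (x 1) (x 3)) /
      (det3 (x 4) (x 1) (x 2) / det3 (x 3) (x 1) (x 2)),
    pslEquivalent_of_det_ne_zero B hdet
      ![det3 (x 0) (x 1) (x 2) / det3 (x 3) (x 1) (x 2),
        det3 (x 0) (x 1) (x 2) / det3 (x 0) (x 3) (x 2),
        det3 (x 0) (x 1) (x 2) / det3 (x 0) (x 1) (x 3), 1,
        det3 (x 4) (x 1) (x 2) / det3 (x 3) (x 1) (x 2)] ?_⟩
  intro i
  rw [hBv]
  constructor
  · fin_cases i <;> simp [h012, h312, h032, h013, h412]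
  · ext k
    fin_cases i <;> fin_cases k <;>
      simp [stdVec, e1, e2, e3, h312, h032, h013]
    all_goals field_simp

/-- The parameters of a normal form in general position. -/
theorem ne_of_inGeneralPosition_stdVec {p q : ℂ} (h : InGeneralPosition (stdVec p q)) :
    p ≠ 0 ∧ q ≠ 0 ∧ p ≠ 1 ∧ q ≠ 1 ∧ p ≠ q := by
  have h1 := h 0 2 4 (by decide) (by decide) (by decide)
  have h2 := h 0 1 4 (by decide) (by decide) (by decide)
  have h3 := h 2 3 4 (by decide) (by decide) (by decide)
  have h4 := h 1 3 4 (by decide) (by decide) (by decide)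
  have h5 := h 0 3 4 (by decide) (by decide) (by decide)
  refine ⟨?_, ?_, ?_, ?_, ?_⟩ <;> rintro rfl
  all_goals simp [det3_eq, stdVec] at h1 h2 h3 h4 h5

/-! ### The invariants in terms of the normal form -/

/-- Each of the five vectors occurs with the same multiplicity in the numerators and in the
denominators of the invariants. -/
theorem permInvariants_eq_of_pslEquivalent {φ ψ φ' ψ' : Fin 5 → EuclideanSpace ℂ (Fin 3)}
    (hφ : PSLEquivalent φ φ') (hψ : PSLEquivalent ψ ψ') (κ : Equiv.Perm (Fin 5)) :
    permInvariants φ ψ κ = permInvariants φ' ψ' κ := by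
  obtain ⟨c, hc, h⟩ := hφ.exists_det3_eq
  obtain ⟨d, hd, h'⟩ := hψ.exists_det3_eq
  have cancel : ∀ u a b a' b' : ℂ, u ≠ 0 → -(u * (a * b) / (u * (a' * b'))) =
      -(a * b / (a' * b')) := fun u a b a' b' hu => by rw [mul_div_mul_left _ _ hu]
  ext k
  simp only [permInvariants, invariants, h, h']
  fin_cases k
  · refine Eq.trans ?_ (cancel (c (κ 0) ^ 2 * c (κ 1) * c (κ 2) * c (κ 3) * c (κ 4)) _ _ _ _ ?_)
    · simp only [Fin.zero_eta, Matrix.cons_val_zero]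
      congr 2 <;> ring
    · simp [hc]
  · refine Eq.trans ?_ (cancel (c (κ 0) * c (κ 1) ^ 2 * c (κ 2) * c (κ 3) * c (κ 4)) _ _ _ _ ?_)
    · simp only [Fin.mk_one, Matrix.cons_val_one, Matrix.cons_val_zero]
      congr 2 <;> ring
    · simp [hc]
  · refine Eq.trans ?_ (cancel (d (κ 0) ^ 2 * d (κ 1) * d (κ 2) * d (κ 3) * d (κ 4)) _ _ _ _ ?_)
    · simp only [Fin.reduceFinMk, Matrix.cons_val]
      congr 2 <;> ring
    · simp [hd]
  · refine Eq.trans ?_ (cancel (d (κ 0) * d (κ 1) * d (κ 2) ^ 2 * d (κ 3) * d (κ 4)) _ _ _ _ ?_)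
    · simp only [Fin.reduceFinMk, Matrix.cons_val]
      congr 2 <;> ring
    · simp [hd]

theorem permInvariants_stdVec {p q r s : ℂ}
    (hpq : p ≠ 0 ∧ q ≠ 0 ∧ p ≠ 1 ∧ q ≠ 1 ∧ p ≠ q) (hrs : r ≠ 0 ∧ s ≠ 0 ∧ r ≠ 1 ∧ s ≠ 1 ∧ r ≠ s)
    (j : Fin 12) (k : Fin 4) :
    permInvariants (stdVec p q) (stdVec r s) (perm j) k = invariantTable p q r s j k := by
  obtain ⟨hp, hq, hp1, hq1, hpq⟩ := hpq
  obtain ⟨hr, hs, hr1, hs1, hrs⟩ := hrs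
  -- the factors of the determinants, in the forms in which their expansions contain them
  have a1 := sub_ne_zero.2 hp1
  have a2 := sub_ne_zero.2 hq1
  have a3 := sub_ne_zero.2 hpq
  have a4 := sub_ne_zero.2 hr1
  have a5 := sub_ne_zero.2 hs1
  have a6 := sub_ne_zero.2 hrs
  have b1 := sub_ne_zero.2 hp1.symm
  have b2 := sub_ne_zero.2 hq1.symm
  have b3 := sub_ne_zero.2 hpq.symm
  have b4 := sub_ne_zero.2 hr1.symm
  have b5 := sub_ne_zero.2 hs1.symm
  have b6 := sub_ne_zero.2 hrs.symm
  have c1 : -p + q ≠ 0 := by rwa [neg_add_eq_sub]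
  have c2 : -q + p ≠ 0 := by rwa [neg_add_eq_sub]
  have c3 : -r + s ≠ 0 := by rwa [neg_add_eq_sub]
  have c4 : -s + r ≠ 0 := by rwa [neg_add_eq_sub]
  have c5 : -p + 1 ≠ 0 := by rwa [neg_add_eq_sub]
  have c6 : -q + 1 ≠ 0 := by rwa [neg_add_eq_sub]
  have c7 : -r + 1 ≠ 0 := by rwa [neg_add_eq_sub]
  have c8 : -s + 1 ≠ 0 := by rwa [neg_add_eq_sub]
  have c9 : -1 + p ≠ 0 := by rwa [neg_add_eq_sub]
  have c10 : -1 + q ≠ 0 := by rwa [neg_add_eq_sub]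
  have c11 : -1 + r ≠ 0 := by rwa [neg_add_eq_sub]
  have c12 : -1 + s ≠ 0 := by rwa [neg_add_eq_sub]
  fin_cases j <;> fin_cases k <;>
    simp [permInvariants, invariants, invariantTable, perm, permRow, stdVec, det3_eq]
  all_goals try field_simp
  all_goals try ring

/-! ### Local transformations of PPT states -/

theorem kronecker_mulVec_prodVec {n m : ℕ} (A : Matrix (Fin n) (Fin n) ℂ)
    (B : Matrix (Fin m) (Fin m) ℂ) (x : EuclideanSpace ℂ (Fin n)) (y : EuclideanSpace ℂ (Fin m)) :
    (A ⊗ₖ B) *ᵥ (prodVec x y).ofLp =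
      (prodVec (Matrix.toEuclideanLin A x) (Matrix.toEuclideanLin B y)).ofLp := by
  ext ij
  simp only [prodVec, Matrix.mulVec, dotProduct, Matrix.kroneckerMap_apply,
    Fintype.sum_prod_type, Matrix.toLpLin_apply, Finset.sum_mul_sum]
  exact Finset.sum_congr rfl fun _ _ => Finset.sum_congr rfl fun _ _ => by ring

theorem partialTranspose_kronecker_conj {n m : ℕ} (A : Matrix (Fin n) (Fin n) ℂ)
    (B : Matrix (Fin m) (Fin m) ℂ) (ρ : Matrix (Fin n × Fin m) (Fin n × Fin m) ℂ) :
    partialTranspose ((A ⊗ₖ B)ᴴ * ρ * (A ⊗ₖ B)) =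
      (A.map star ⊗ₖ B)ᴴ * partialTranspose ρ * (A.map star ⊗ₖ B) := by
  ext ⟨a, b⟩ ⟨c, d⟩
  simp only [partialTranspose, Matrix.of_apply, Matrix.mul_apply, Matrix.conjTranspose_apply,
    Matrix.kroneckerMap_apply, Matrix.map_apply, Fintype.sum_prod_type, star_mul', star_star,
    Finset.sum_mul]
  -- the summation indices of the first factor are interchanged
  calc _ = ∑ k, ∑ l, ∑ i, ∑ j, star (A i c) * star (B j b) * ρ (i, j) (k, l) * (A k a * B l d) := rfl
    _ = ∑ k, ∑ i, ∑ l, ∑ j, star (A i c) * star (B j b) * ρ (i, j) (k, l) * (A k a * B l d) :=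
        Finset.sum_congr rfl fun _ _ => Finset.sum_comm
    _ = ∑ i, ∑ k, ∑ l, ∑ j, star (A i c) * star (B j b) * ρ (i, j) (k, l) * (A k a * B l d) :=
        Finset.sum_comm
    _ = ∑ i, ∑ l, ∑ k, ∑ j, star (A i c) * star (B j b) * ρ (i, j) (k, l) * (A k a * B l d) :=
        Finset.sum_congr rfl fun _ _ => Finset.sum_comm
    _ = _ := by
        refine Finset.sum_congr rfl fun _ _ => Finset.sum_congr rfl fun _ _ =>
          Finset.sum_congr rfl fun _ _ => Finset.sum_congr rfl fun _ _ => ?_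
        ring

/-- There is a PPT state of rank `4` whose kernel contains all `φ i ⊗ ψ i`. -/
def HasPPTState (φ ψ : Fin 5 → EuclideanSpace ℂ (Fin 3)) : Prop :=
  ∃ ρ : Matrix (Fin 3 × Fin 3) (Fin 3 × Fin 3) ℂ, IsPPTState ρ ∧ ρ.rank = 4 ∧
    ∀ i, prodVec (φ i) (ψ i) ∈ LinearMap.ker (Matrix.toEuclideanLin ρ)

theorem mem_ker_toEuclideanLin_iff {ι : Type*} [Fintype ι] [DecidableEq ι]
    (ρ : Matrix ι ι ℂ) (x : EuclideanSpace ℂ ι) :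
    x ∈ LinearMap.ker (Matrix.toEuclideanLin ρ) ↔ ρ *ᵥ x.ofLp = 0 := by
  simp [LinearMap.mem_ker, Matrix.toLpLin_apply]

/-- The states are pulled back along `A ⊗ B`. -/
theorem HasPPTState.of_pslEquivalent {φ ψ φ' ψ' : Fin 5 → EuclideanSpace ℂ (Fin 3)}
    (h : HasPPTState φ' ψ') (hφ : PSLEquivalent φ φ') (hψ : PSLEquivalent ψ ψ') :
    HasPPTState φ ψ := by
  obtain ⟨ρ, hρ, hr, hk⟩ := h
  obtain ⟨A, c, hA⟩ := hφ
  obtain ⟨B, d, hB⟩ := hψ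
  set U : Matrix (Fin 3 × Fin 3) (Fin 3 × Fin 3) ℂ :=
    (A : Matrix (Fin 3) (Fin 3) ℂ) ⊗ₖ (B : Matrix (Fin 3) (Fin 3) ℂ) with hU
  have hdet : IsUnit U.det := by simp [hU, Matrix.det_kronecker]
  have hdet' : IsUnit Uᴴ.det := by rw [Matrix.det_conjTranspose]; exact hdet.star
  have hrank : (Uᴴ * ρ * U).rank = 4 := by
    rw [Matrix.rank_mul_eq_left_of_isUnit_det _ _ hdet,
      Matrix.rank_mul_eq_right_of_isUnit_det _ _ hdet', hr]
  refine ⟨Uᴴ * ρ * U, ⟨?_, hρ.posSemidef.conjTranspose_mul_mul_same U, ?_⟩, hrank, fun i => ?_⟩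
  · intro h0
    simp [h0] at hrank
  · rw [hU, partialTranspose_kronecker_conj]
    exact hρ.posSemidef_partialTranspose.conjTranspose_mul_mul_same _
  · have h1 := hk i
    rw [mem_ker_toEuclideanLin_iff] at h1 ⊢
    have h2 : prodVec (c i • φ' i) (d i • ψ' i) = (c i * d i) • prodVec (φ' i) (ψ' i) := by
      ext ij
      simp [prodVec]
      ring
    rw [← Matrix.mulVec_mulVec, ← Matrix.mulVec_mulVec, hU, kronecker_mulVec_prodVec, (hA i).2,
      (hB i).2, h2, WithLp.ofLp_smul, Matrix.mulVec_smul, h1, smul_zero, Matrix.mulVec_zero]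

/-- A product vector in the kernel of `ρ` gives one in the kernel of the partial transpose: both
expectation values agree. -/
theorem partialTranspose_mulVec_eq_zero {n m : ℕ} {ρ : Matrix (Fin n × Fin m) (Fin n × Fin m) ℂ}
    (hρ : (partialTranspose ρ).PosSemidef) {x : Fin n → ℂ} {y : Fin m → ℂ}
    (h : ρ *ᵥ (fun ij => x ij.1 * y ij.2) = 0) :
    partialTranspose ρ *ᵥ (fun ij => star (x ij.1) * y ij.2) = 0 := by
  rw [← hρ.dotProduct_mulVec_zero_iff]
  have h0 : star (fun ij : Fin n × Fin m => x ij.1 * y ij.2) ⬝ᵥ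
      (ρ *ᵥ (fun ij => x ij.1 * y ij.2)) = 0 := by rw [h, dotProduct_zero]
  rw [← h0]
  simp only [dotProduct, Matrix.mulVec, partialTranspose, Matrix.of_apply, Fintype.sum_prod_type,
    Pi.star_apply, star_mul', star_star, Finset.mul_sum]
  calc _ = ∑ i, ∑ k, ∑ j, ∑ l, x i * star (y j) * (ρ (k, j) (i, l) * (star (x k) * y l)) :=
        Finset.sum_congr rfl fun _ _ => Finset.sum_comm
    _ = ∑ k, ∑ i, ∑ j, ∑ l, x i * star (y j) * (ρ (k, j) (i, l) * (star (x k) * y l)) :=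
        Finset.sum_comm
    _ = ∑ k, ∑ j, ∑ i, ∑ l, x i * star (y j) * (ρ (k, j) (i, l) * (star (x k) * y l)) :=
        Finset.sum_congr rfl fun _ _ => Finset.sum_comm
    _ = _ := by
        refine Finset.sum_congr rfl fun _ _ => Finset.sum_congr rfl fun _ _ =>
          Finset.sum_congr rfl fun _ _ => Finset.sum_congr rfl fun _ _ => ?_
        ring

/-! ### The hexagon of off-diagonal indices -/

/-- The differences of the six off-diagonal entries of `(1, p, q) ⊗ (1, r, s)` along the cycle
`(0,1), (0,2), (1,2), (1,0), (2,0), (2,1)` of index pairs. -/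
def hexDiff (p q r s : ℝ) : Fin 6 → ℝ :=
  ![s - r, s * (p - 1), p * (1 - s), q - p, q * (r - 1), r * (1 - q)]

theorem ofReal_re_of_star_eq {z : ℂ} (h : star z = z) : ((z.re : ℝ) : ℂ) = z :=
  Complex.conj_eq_iff_re.1 h

/-- A PPT state whose kernel contains the product vectors in normal form is a weighted Laplacian of
the hexagon: with rows and columns `(i, i)` of the state and of its partial transpose zero, the only
remaining entries are those on and next to the diagonal. The vectors `(1,1,1) ⊗ (1,1,1)` and
`(1,p,q) ⊗ (1,r,s)`, together with their counterparts for the partial transpose, force all entries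
and all parameters to be real and the weights to be inversely proportional to `hexDiff`. Positivity
leaves at most one negative weight `-e k`. -/
theorem exists_weights_of_isPPTState {p q r s : ℂ}
    (hpq : p ≠ 0 ∧ q ≠ 0 ∧ p ≠ 1 ∧ q ≠ 1 ∧ p ≠ q) (hrs : r ≠ 0 ∧ s ≠ 0 ∧ r ≠ 1 ∧ s ≠ 1 ∧ r ≠ s)
    {ρ : Matrix (Fin 3 × Fin 3) (Fin 3 × Fin 3) ℂ} (hρ : IsPPTState ρ)
    (hk : ∀ i, ρ *ᵥ (fun ij => stdVec p q i ij.1 * stdVec r s i ij.2) = 0) :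
    ∃ p' q' r' s' : ℝ, p = p' ∧ q = q' ∧ r = r' ∧ s = s' ∧
      ∃ (e : Fin 6 → ℝ) (c : ℝ), c ≠ 0 ∧ (∀ k, e k * hexDiff p' q' r' s' k = c) ∧
        ∀ k l, k < l → e k + e l ≤ 0 := by
  obtain ⟨hp, hq, hp1, hq1, hpq⟩ := hpq
  obtain ⟨hr, hs, hr1, hs1, hrs⟩ := hrs
  have hΓ := fun i => partialTranspose_mulVec_eq_zero hρ.posSemidef_partialTranspose (hk i)
  have herm : ∀ x y, star (ρ x y) = ρ y x := fun x y => hρ.posSemidef.1.apply y x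
  -- the first three kernel vectors, for the state and for its partial transpose
  have z1 : ∀ a b i, ρ (a, b) (i, i) = 0 := by
    intro a b i
    have h0 := congrFun (hk 0) (a, b)
    have h1 := congrFun (hk 1) (a, b)
    have h2 := congrFun (hk 2) (a, b)
    fin_cases i
    · simpa [Matrix.mulVec, dotProduct, Fintype.sum_prod_type, Fin.sum_univ_three, stdVec] using h0
    · simpa [Matrix.mulVec, dotProduct, Fintype.sum_prod_type, Fin.sum_univ_three, stdVec] using h1
    · simpa [Matrix.mulVec, dotProduct, Fintype.sum_prod_type, Fin.sum_univ_three, stdVec] using h2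
  have z2 : ∀ a b i, ρ (i, b) (a, i) = 0 := by
    intro a b i
    have h0 := congrFun (hΓ 0) (a, b)
    have h1 := congrFun (hΓ 1) (a, b)
    have h2 := congrFun (hΓ 2) (a, b)
    fin_cases i
    · simpa [Matrix.mulVec, dotProduct, Fintype.sum_prod_type, Fin.sum_univ_three, stdVec,
        partialTranspose] using h0
    · simpa [Matrix.mulVec, dotProduct, Fintype.sum_prod_type, Fin.sum_univ_three, stdVec,
        partialTranspose] using h1
    · simpa [Matrix.mulVec, dotProduct, Fintype.sum_prod_type, Fin.sum_univ_three, stdVec,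
        partialTranspose] using h2
  have z3 : ∀ a b i, ρ (i, i) (a, b) = 0 := fun a b i => by rw [← herm, z1, star_zero]
  have z4 : ∀ a b i, ρ (a, i) (i, b) = 0 := fun a b i => by rw [← herm, z2, star_zero]
  -- the fourth and the fifth kernel vector
  have u := fun a b => congrFun (hk 3) (a, b)
  have v := fun a b => congrFun (hk 4) (a, b)
  have u' := fun a b => congrFun (hΓ 3) (a, b)
  have v' := fun a b => congrFun (hΓ 4) (a, b)
  simp only [Matrix.mulVec, dotProduct, Fintype.sum_prod_type, Fin.sum_univ_three, stdVec,
    partialTranspose, Matrix.of_apply, Pi.zero_apply, Matrix.cons_val, z1, z2, one_mul,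
    mul_one, star_one, zero_mul] at u v u' v'
  have u1 := u 0 1
  have u2 := u 0 2
  have u3 := u 1 2
  have u4 := u 1 0
  have u5 := u 2 0
  have u6 := u 2 1
  have v1 := v 0 1
  have v2 := v 0 2
  have v3 := v 1 2
  have v4 := v 1 0
  have v5 := v 2 0
  have v6 := v 2 1
  have t1 := u' 0 1
  have t2 := u' 0 2
  have t4 := u' 1 0
  have y1 := v' 0 1
  have y2 := v' 0 2
  clear u v u' v'
  simp only [z2, z4, zero_add, add_zero] at u1 u2 u3 u4 u5 u6
  simp only [z2, z4, zero_mul, zero_add, add_zero] at v1 v2 v3 v4 v5 v6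
  simp only [z1, z3, zero_mul, zero_add, add_zero] at t1 t2 t4 y1 y2
  -- symmetry of the off-diagonal entries, hence reality
  have s6 : ρ (0, 1) (2, 1) = ρ (2, 1) (0, 1) := by linear_combination u1 - t1
  have s2 : ρ (1, 2) (0, 2) = ρ (0, 2) (1, 2) := by linear_combination t2 - u2
  have s4 : ρ (2, 0) (1, 0) = ρ (1, 0) (2, 0) := by linear_combination t4 - u4
  have s1 : ρ (0, 2) (0, 1) = ρ (0, 1) (0, 2) := by
    have h := congrArg star u1
    simp only [star_add, herm, star_zero] at h
    linear_combination h - u1 + s6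
  have s3 : ρ (1, 0) (1, 2) = ρ (1, 2) (1, 0) := by
    have h := congrArg star u3
    simp only [star_add, herm, star_zero] at h
    linear_combination h - u3 + s2
  have s5 : ρ (2, 1) (2, 0) = ρ (2, 0) (2, 1) := by
    have h := congrArg star u5
    simp only [star_add, herm, star_zero] at h
    linear_combination h - u5 + s4
  rw [s6] at u1 v1
  rw [s1] at u2 v2 y2
  rw [s2] at u3 v3 y2
  rw [s3] at u4 v4
  rw [s4] at u5 v5
  rw [s5] at u6 v6
  have r1 := ofReal_re_of_star_eq ((herm (0, 1) (0, 2)).trans s1)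
  have r2 := ofReal_re_of_star_eq ((herm (0, 2) (1, 2)).trans s2)
  have r3 := ofReal_re_of_star_eq ((herm (1, 2) (1, 0)).trans s3)
  have r4 := ofReal_re_of_star_eq ((herm (1, 0) (2, 0)).trans s4)
  have r5 := ofReal_re_of_star_eq ((herm (2, 0) (2, 1)).trans s5)
  have r6 := ofReal_re_of_star_eq ((herm (2, 1) (0, 1)).trans s6)
  generalize (ρ (0, 1) (0, 2)).re = e1 at r1
  generalize (ρ (0, 2) (1, 2)).re = e2 at r2
  generalize (ρ (1, 2) (1, 0)).re = e3 at r3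
  generalize (ρ (1, 0) (2, 0)).re = e4 at r4
  generalize (ρ (2, 0) (2, 1)).re = e5 at r5
  generalize (ρ (2, 1) (0, 1)).re = e6 at r6
  rw [← r1, ← r6] at u1 v1 y1
  rw [← r1, ← r2] at u2 v2 y2
  rw [← r2, ← r3] at u3 v3
  rw [← r3, ← r4] at u4 v4
  rw [← r4, ← r5] at u5 v5
  rw [← r5, ← r6] at u6 v6
  have d1 : ρ (0, 1) (0, 1) = -(e1 + e6) := by linear_combination u1
  have d2 : ρ (0, 2) (0, 2) = -(e1 + e2) := by linear_combination u2
  have d3 : ρ (1, 2) (1, 2) = -(e2 + e3) := by linear_combination u3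
  have d4 : ρ (1, 0) (1, 0) = -(e3 + e4) := by linear_combination u4
  have d5 : ρ (2, 0) (2, 0) = -(e4 + e5) := by linear_combination u5
  have d6 : ρ (2, 1) (2, 1) = -(e5 + e6) := by linear_combination u6
  rw [d1] at v1 y1
  rw [d2] at v2 y2
  rw [d3] at v3
  rw [d4] at v4
  rw [d5] at v5
  rw [d6] at v6
  have c2 : (e2 : ℂ) * (s * (p - 1)) = e1 * (s - r) := by linear_combination v2
  have c3 : (e3 : ℂ) * (p * (1 - s)) = e1 * (s - r) := by linear_combination c2 + v3
  have c4 : (e4 : ℂ) * (q - p) = e1 * (s - r) := by linear_combination c3 + v4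
  have c5 : (e5 : ℂ) * (q * (r - 1)) = e1 * (s - r) := by linear_combination c4 + v5
  have c6 : (e6 : ℂ) * (r * (1 - q)) = e1 * (s - r) := by linear_combination c5 + v6
  have w1 : s - r ≠ 0 := sub_ne_zero.2 hrs.symm
  have w2 : s * (p - 1) ≠ 0 := mul_ne_zero hs (sub_ne_zero.2 hp1)
  have w3 : p * (1 - s) ≠ 0 := mul_ne_zero hp (sub_ne_zero.2 hs1.symm)
  have w4 : q - p ≠ 0 := sub_ne_zero.2 hpq.symm
  have w5 : q * (r - 1) ≠ 0 := mul_ne_zero hq (sub_ne_zero.2 hr1)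
  have w6 : r * (1 - q) ≠ 0 := mul_ne_zero hr (sub_ne_zero.2 hq1.symm)
  -- otherwise the state would vanish
  have he1 : (e1 : ℂ) ≠ 0 := by
    intro h0
    rw [h0, zero_mul] at c2 c3 c4 c5 c6
    have k2 := (mul_eq_zero.1 c2).resolve_right w2
    have k3 := (mul_eq_zero.1 c3).resolve_right w3
    have k4 := (mul_eq_zero.1 c4).resolve_right w4
    have k5 := (mul_eq_zero.1 c5).resolve_right w5
    have k6 := (mul_eq_zero.1 c6).resolve_right w6
    refine hρ.ne_zero (Matrix.ext ?_)
    rintro ⟨a, b⟩ ⟨c, d⟩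
    fin_cases a <;> fin_cases b <;> fin_cases c <;> fin_cases d <;>
      simp [z1, z2, z3, z4, s1, s2, s3, s4, s5, s6, ← r1, ← r2, ← r3, ← r4, ← r5, ← r6,
        d1, d2, d3, d4, d5, d6, h0, k2, k3, k4, k5, k6]
  have hc : (e1 : ℂ) * (s - r) ≠ 0 := mul_ne_zero he1 w1
  have he2 : (e2 : ℂ) ≠ 0 := by rw [← c2] at hc; exact left_ne_zero_of_mul hc
  have he3 : (e3 : ℂ) ≠ 0 := by rw [← c3] at hc; exact left_ne_zero_of_mul hc
  have he5 : (e5 : ℂ) ≠ 0 := by rw [← c5] at hc; exact left_ne_zero_of_mul hc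
  have he6 : (e6 : ℂ) ≠ 0 := by rw [← c6] at hc; exact left_ne_zero_of_mul hc
  -- the kernel conditions for the state and for its partial transpose differ only in a conjugation
  -- of `q` and `p`; those for `s` and `r` come from conjugating equations whose other terms are real
  have hq' := ofReal_re_of_star_eq (z := q)
    (mul_left_cancel₀ (mul_ne_zero he6 hr) (by linear_combination y1 - v1))
  have hp' := ofReal_re_of_star_eq (z := p)
    (mul_left_cancel₀ (mul_ne_zero he2 hs) (by linear_combination y2 - v2))
  generalize q.re = q' at hq'
  generalize p.re = p' at hp'
  subst hq' hp'
  have v4' := congrArg star v4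
  have v5' := congrArg star v5
  simp only [star_add, star_mul', star_neg, Complex.star_def, Complex.conj_ofReal, map_zero]
    at v4' v5'
  have hs' := ofReal_re_of_star_eq (z := s)
    (mul_left_cancel₀ (mul_ne_zero he3 hp) (by
      simp only [Complex.star_def]; linear_combination v4' - v4))
  have hr' := ofReal_re_of_star_eq (z := r)
    (mul_left_cancel₀ (mul_ne_zero he5 hq) (by
      simp only [Complex.star_def]; linear_combination v5' - v5))
  generalize r.re = r' at hr'
  generalize s.re = s' at hs'
  subst hr' hs'
  -- the form defined by `ρ` on real vectors supported on the hexagon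
  have hQ : ∀ x : Fin 6 → ℝ, 0 ≤ -(e1 * (x 1 - x 0) ^ 2 + e2 * (x 2 - x 1) ^ 2 +
      e3 * (x 3 - x 2) ^ 2 + e4 * (x 4 - x 3) ^ 2 + e5 * (x 5 - x 4) ^ 2 +
      e6 * (x 0 - x 5) ^ 2) := by
    intro x
    have h := hρ.posSemidef.dotProduct_mulVec_nonneg
      (fun ij => ((![![0, x 0, x 1], ![x 3, 0, x 2], ![x 4, x 5, 0]] ij.1 ij.2 : ℝ) : ℂ))
    rw [← Complex.zero_le_real]
    refine h.trans_eq ?_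
    simp [Matrix.mulVec, dotProduct, Fintype.sum_prod_type, Fin.sum_univ_three, z1, z2, z3, z4,
      s1, s2, s3, s4, s5, s6, ← r1, ← r2, ← r3, ← r4, ← r5, ← r6, d1, d2, d3, d4, d5, d6]
    ring
  refine ⟨p', q', r', s', rfl, rfl, rfl, rfl, ![e1, e2, e3, e4, e5, e6], e1 * (s' - r'),
    by exact_mod_cast hc, ?_, ?_⟩
  · intro k
    fin_cases k
    · rfl
    · exact_mod_cast c2
    · exact_mod_cast c3
    · exact_mod_cast c4
    · exact_mod_cast c5
    · exact_mod_cast c6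
  · intro k l hkl
    -- the indicator function of an arc has nonzero differences only at the ends of the arc
    have h := hQ fun i => if k < i ∧ i ≤ l then 1 else 0
    fin_cases k <;> fin_cases l <;> simp at hkl h ⊢ <;> linarith

/-! ### Sign patterns and the twelve permutations -/

/-- The differences along the closed hexagon add up to zero, so they do not all have the same sign,
and at most one of the weights `-e k = -c / hexDiff k` is negative. -/
theorem exists_sign_pattern {p q r s : ℝ} {e : Fin 6 → ℝ} {c : ℝ} (hc : c ≠ 0)
    (h : ∀ k, e k * hexDiff p q r s k = c) (he : ∀ k l, k < l → e k + e l ≤ 0) :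
    ∃ m : Fin 6,
      (0 < hexDiff p q r s m ∧ ∀ k, k ≠ m → hexDiff p q r s k < 0) ∨
      (hexDiff p q r s m < 0 ∧ ∀ k, k ≠ m → 0 < hexDiff p q r s k) := by
  have hw : ∀ k, hexDiff p q r s k ≠ 0 := fun k h0 => hc (by rw [← h k, h0, mul_zero])
  have hsum : ∑ k, hexDiff p q r s k = 0 := by
    simp [hexDiff, Fin.sum_univ_succ]
    ring
  -- two positive entries of `e` are impossible
  have he' : ∀ k l, k ≠ l → 0 < e k → e l < 0 := by
    intro k l hkl hk
    rcases lt_or_gt_of_ne hkl with h' | h'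
    · linarith [he k l h']
    · linarith [he l k h']
  rcases lt_or_gt_of_ne hc with hc | hc
  · have h1 : ∀ k, hexDiff p q r s k < 0 → 0 < e k := fun k hk => by
      by_contra! h0
      have := mul_nonneg_of_nonpos_of_nonpos h0 hk.le
      linarith [h k]
    have h2 : ∀ k, e k < 0 → 0 < hexDiff p q r s k := fun k hk => by
      by_contra! h0
      have := mul_nonneg_of_nonpos_of_nonpos hk.le h0
      linarith [h k]
    obtain ⟨m, -, hm⟩ : ∃ m ∈ Finset.univ, hexDiff p q r s m < 0 := by
      by_contra! h0
      exact hw 0 ((Finset.sum_eq_zero_iff_of_nonneg h0).1 hsum 0 (Finset.mem_univ _))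
    exact ⟨m, Or.inr ⟨hm, fun k hk => h2 k (he' m k hk.symm (h1 m hm))⟩⟩
  · have h1 : ∀ k, 0 < hexDiff p q r s k → 0 < e k := fun k hk => by
      by_contra! h0
      have := mul_nonpos_of_nonpos_of_nonneg h0 hk.le
      linarith [h k]
    have h2 : ∀ k, e k < 0 → hexDiff p q r s k < 0 := fun k hk => by
      by_contra! h0
      have := mul_nonpos_of_nonpos_of_nonneg hk.le h0
      linarith [h k]
    obtain ⟨m, -, hm⟩ : ∃ m ∈ Finset.univ, 0 < hexDiff p q r s m := by
      by_contra! h0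
      exact hw 0 ((Finset.sum_eq_zero_iff_of_nonpos h0).1 hsum 0 (Finset.mem_univ _))
    exact ⟨m, Or.inl ⟨hm, fun k hk => h2 k (he' m k hk.symm (h1 m hm))⟩⟩

/-- The regions of real parameters in which the rows of the table are positive. -/
def signRegion (p q r s : ℝ) : Fin 12 → Prop :=
  ![p < 0 ∧ 1 < q ∧ 0 < s ∧ s < r ∧ r < 1,
    q < 0 ∧ 1 < p ∧ 0 < r ∧ r < s ∧ s < 1,
    q < p ∧ p < 0 ∧ 0 < s ∧ s < 1 ∧ 1 < r,
    q < 0 ∧ 0 < p ∧ p < 1 ∧ 1 < s ∧ s < r,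
    p < q ∧ q < 0 ∧ 0 < r ∧ r < 1 ∧ 1 < s,
    p < 0 ∧ 0 < q ∧ q < 1 ∧ 1 < r ∧ r < s,
    1 < q ∧ q < p ∧ s < 0 ∧ 0 < r ∧ r < 1,
    0 < q ∧ q < 1 ∧ 1 < p ∧ s < r ∧ r < 0,
    0 < p ∧ p < q ∧ q < 1 ∧ s < 0 ∧ 1 < r,
    0 < q ∧ q < p ∧ p < 1 ∧ r < 0 ∧ 1 < s,
    1 < p ∧ p < q ∧ r < 0 ∧ 0 < s ∧ s < 1,
    0 < p ∧ p < 1 ∧ 1 < q ∧ r < s ∧ s < 0]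

theorem invariantTable_pos_of_signRegion {p q r s : ℝ} {j : Fin 12}
    (h : signRegion p q r s j) (k : Fin 4) : 0 < invariantTable p q r s j k := by
  have row : ∀ a b c d : ℝ, (0 < a ∧ 0 < b ∧ 0 < c ∧ 0 < d) →
      ∀ k, 0 < (![(a : ℂ), (b : ℂ), (c : ℂ), (d : ℂ)] k) := by
    rintro a b c d ⟨h1, h2, h3, h4⟩ k
    fin_cases k <;> simpa
  fin_cases j <;> obtain ⟨h1, h2, h3, h4, h5⟩ := h
  · have := row (-(p / q)) (q - 1) ((r - s) / s) (r / (1 - r))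
      ⟨neg_pos.2 (div_neg_of_neg_of_pos (by linarith) (by linarith)),
        by linarith,
        div_pos (by linarith) (by linarith),
        div_pos (by linarith) (by linarith)⟩ k
    push_cast at this
    exact this
  · have := row (-(q / p)) (p - 1) ((s - r) / r) (s / (1 - s))
      ⟨neg_pos.2 (div_neg_of_neg_of_pos (by linarith) (by linarith)),
        by linarith,
        div_pos (by linarith) (by linarith),
        div_pos (by linarith) (by linarith)⟩ k
    push_cast at this
    exact this
  · have := row (-(1 / q)) ((q - p) / p) ((1 - s) / s) (1 / (r - 1))
      ⟨neg_pos.2 (div_neg_of_pos_of_neg (by linarith) (by linarith)),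
        div_pos_of_neg_of_neg (by linarith) (by linarith),
        div_pos (by linarith) (by linarith),
        div_pos (by linarith) (by linarith)⟩ k
    push_cast at this
    exact this
  · have := row (-q) ((1 - p) / p) (s - 1) (s / (r - s))
      ⟨by linarith,
        div_pos (by linarith) (by linarith),
        by linarith,
        div_pos (by linarith) (by linarith)⟩ k
    push_cast at this
    exact this
  · have := row (-(1 / p)) ((p - q) / q) ((1 - r) / r) (1 / (s - 1))
      ⟨neg_pos.2 (div_neg_of_pos_of_neg (by linarith) (by linarith)),
        div_pos_of_neg_of_neg (by linarith) (by linarith),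
        div_pos (by linarith) (by linarith),
        div_pos (by linarith) (by linarith)⟩ k
    push_cast at this
    exact this
  · have := row (-p) ((1 - q) / q) (r - 1) (r / (s - r))
      ⟨by linarith,
        div_pos (by linarith) (by linarith),
        by linarith,
        div_pos (by linarith) (by linarith)⟩ k
    push_cast at this
    exact this
  · have := row ((p - q) / q) (1 / (q - 1)) (-(r / s)) ((s - r) / (r - 1))
      ⟨div_pos (by linarith) (by linarith),
        div_pos (by linarith) (by linarith),
        neg_pos.2 (div_neg_of_pos_of_neg (by linarith) (by linarith)),
        div_pos_of_neg_of_neg (by linarith) (by linarith)⟩ k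
    push_cast at this
    exact this
  · have := row (q / (p - q)) ((1 - p) / (q - 1)) (r / (s - r)) (-s)
      ⟨div_pos (by linarith) (by linarith),
        div_pos_of_neg_of_neg (by linarith) (by linarith),
        div_pos_of_neg_of_neg (by linarith) (by linarith),
        by linarith⟩ k
    push_cast at this
    exact this
  · have := row (-((q - 1) / q)) (p / (q - p)) (-(1 / s)) ((1 - s) / (r - 1))
      ⟨neg_pos.2 (div_neg_of_neg_of_pos (by linarith) (by linarith)),
        div_pos (by linarith) (by linarith),
        neg_pos.2 (div_neg_of_pos_of_neg (by linarith) (by linarith)),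
        div_pos (by linarith) (by linarith)⟩ k
    push_cast at this
    exact this
  · have := row (q / (1 - q)) ((p - 1) / (q - p)) (1 / (s - 1)) (-(s / r))
      ⟨div_pos (by linarith) (by linarith),
        div_pos_of_neg_of_neg (by linarith) (by linarith),
        div_pos (by linarith) (by linarith),
        neg_pos.2 (div_neg_of_pos_of_neg (by linarith) (by linarith))⟩ k
    push_cast at this
    exact this
  · have := row ((q - p) / p) (1 / (p - 1)) (-(s / r)) ((r - s) / (s - 1))
      ⟨div_pos (by linarith) (by linarith),
        div_pos (by linarith) (by linarith),
        neg_pos.2 (div_neg_of_pos_of_neg (by linarith) (by linarith)),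
        div_pos_of_neg_of_neg (by linarith) (by linarith)⟩ k
    push_cast at this
    exact this
  · have := row (p / (q - p)) ((1 - q) / (p - 1)) (s / (r - s)) (-r)
      ⟨div_pos (by linarith) (by linarith),
        div_pos_of_neg_of_neg (by linarith) (by linarith),
        div_pos_of_neg_of_neg (by linarith) (by linarith),
        by linarith⟩ k
    push_cast at this
    exact this

/-- A case distinction on the signs of the factors of the differences. -/
theorem exists_signRegion {p q r s : ℝ} {m : Fin 6}
    (h : (0 < hexDiff p q r s m ∧ ∀ k, k ≠ m → hexDiff p q r s k < 0) ∨
      (hexDiff p q r s m < 0 ∧ ∀ k, k ≠ m → 0 < hexDiff p q r s k)) :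
    ∃ j, signRegion p q r s j := by
  have R0 : p < 0 ∧ 1 < q ∧ 0 < s ∧ s < r ∧ r < 1 → ∃ j, signRegion p q r s j := fun h => ⟨0, h⟩
  have R1 : q < 0 ∧ 1 < p ∧ 0 < r ∧ r < s ∧ s < 1 → ∃ j, signRegion p q r s j := fun h => ⟨1, h⟩
  have R2 : q < p ∧ p < 0 ∧ 0 < s ∧ s < 1 ∧ 1 < r → ∃ j, signRegion p q r s j := fun h => ⟨2, h⟩
  have R3 : q < 0 ∧ 0 < p ∧ p < 1 ∧ 1 < s ∧ s < r → ∃ j, signRegion p q r s j := fun h => ⟨3, h⟩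
  have R4 : p < q ∧ q < 0 ∧ 0 < r ∧ r < 1 ∧ 1 < s → ∃ j, signRegion p q r s j := fun h => ⟨4, h⟩
  have R5 : p < 0 ∧ 0 < q ∧ q < 1 ∧ 1 < r ∧ r < s → ∃ j, signRegion p q r s j := fun h => ⟨5, h⟩
  have R6 : 1 < q ∧ q < p ∧ s < 0 ∧ 0 < r ∧ r < 1 → ∃ j, signRegion p q r s j := fun h => ⟨6, h⟩
  have R7 : 0 < q ∧ q < 1 ∧ 1 < p ∧ s < r ∧ r < 0 → ∃ j, signRegion p q r s j := fun h => ⟨7, h⟩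
  have R8 : 0 < p ∧ p < q ∧ q < 1 ∧ s < 0 ∧ 1 < r → ∃ j, signRegion p q r s j := fun h => ⟨8, h⟩
  have R9 : 0 < q ∧ q < p ∧ p < 1 ∧ r < 0 ∧ 1 < s → ∃ j, signRegion p q r s j := fun h => ⟨9, h⟩
  have R10 : 1 < p ∧ p < q ∧ r < 0 ∧ 0 < s ∧ s < 1 → ∃ j, signRegion p q r s j := fun h => ⟨10, h⟩
  have R11 : 0 < p ∧ p < 1 ∧ 1 < q ∧ r < s ∧ s < 0 → ∃ j, signRegion p q r s j := fun h => ⟨11, h⟩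
  rcases h with ⟨h0, h⟩ | ⟨h0, h⟩ <;> fin_cases m
  all_goals
    have a0 := h 0
    have a1 := h 1
    have a2 := h 2
    have a3 := h 3
    have a4 := h 4
    have a5 := h 5
    clear h
    simp [hexDiff, mul_pos_iff, mul_neg_iff] at h0 a0 a1 a2 a3 a4 a5
  · rcases a1 with ⟨_, _⟩ | ⟨_, _⟩ <;> rcases a2 with ⟨_, _⟩ | ⟨_, _⟩ <;>
      rcases a4 with ⟨_, _⟩ | ⟨_, _⟩ <;> rcases a5 with ⟨_, _⟩ | ⟨_, _⟩ <;>
      first | (exfalso; linarith) |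
      (refine R9 ⟨?_, ?_, ?_, ?_, ?_⟩ <;> linarith)
  · rcases h0 with ⟨_, _⟩ | ⟨_, _⟩ <;> rcases a2 with ⟨_, _⟩ | ⟨_, _⟩ <;>
      rcases a4 with ⟨_, _⟩ | ⟨_, _⟩ <;> rcases a5 with ⟨_, _⟩ | ⟨_, _⟩ <;>
      first | (exfalso; linarith)
  · rcases a1 with ⟨_, _⟩ | ⟨_, _⟩ <;> rcases h0 with ⟨_, _⟩ | ⟨_, _⟩ <;>
      rcases a4 with ⟨_, _⟩ | ⟨_, _⟩ <;> rcases a5 with ⟨_, _⟩ | ⟨_, _⟩ <;>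
      first | (exfalso; linarith) |
      (refine R6 ⟨?_, ?_, ?_, ?_, ?_⟩ <;> linarith) |
      (refine R7 ⟨?_, ?_, ?_, ?_, ?_⟩ <;> linarith)
  · rcases a1 with ⟨_, _⟩ | ⟨_, _⟩ <;> rcases a2 with ⟨_, _⟩ | ⟨_, _⟩ <;>
      rcases a4 with ⟨_, _⟩ | ⟨_, _⟩ <;> rcases a5 with ⟨_, _⟩ | ⟨_, _⟩ <;>
      first | (exfalso; linarith) |
      (refine R0 ⟨?_, ?_, ?_, ?_, ?_⟩ <;> linarith)
  · rcases a1 with ⟨_, _⟩ | ⟨_, _⟩ <;> rcases a2 with ⟨_, _⟩ | ⟨_, _⟩ <;>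
      rcases h0 with ⟨_, _⟩ | ⟨_, _⟩ <;> rcases a5 with ⟨_, _⟩ | ⟨_, _⟩ <;>
      first | (exfalso; linarith)
  · rcases a1 with ⟨_, _⟩ | ⟨_, _⟩ <;> rcases a2 with ⟨_, _⟩ | ⟨_, _⟩ <;>
      rcases a4 with ⟨_, _⟩ | ⟨_, _⟩ <;> rcases h0 with ⟨_, _⟩ | ⟨_, _⟩ <;>
      first | (exfalso; linarith) |
      (refine R2 ⟨?_, ?_, ?_, ?_, ?_⟩ <;> linarith) |
      (refine R3 ⟨?_, ?_, ?_, ?_, ?_⟩ <;> linarith)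
  · rcases a1 with ⟨_, _⟩ | ⟨_, _⟩ <;> rcases a2 with ⟨_, _⟩ | ⟨_, _⟩ <;>
      rcases a4 with ⟨_, _⟩ | ⟨_, _⟩ <;> rcases a5 with ⟨_, _⟩ | ⟨_, _⟩ <;>
      first | (exfalso; linarith) |
      (refine R8 ⟨?_, ?_, ?_, ?_, ?_⟩ <;> linarith)
  · rcases h0 with ⟨_, _⟩ | ⟨_, _⟩ <;> rcases a2 with ⟨_, _⟩ | ⟨_, _⟩ <;>
      rcases a4 with ⟨_, _⟩ | ⟨_, _⟩ <;> rcases a5 with ⟨_, _⟩ | ⟨_, _⟩ <;>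
      first | (exfalso; linarith) |
      (refine R4 ⟨?_, ?_, ?_, ?_, ?_⟩ <;> linarith) |
      (refine R5 ⟨?_, ?_, ?_, ?_, ?_⟩ <;> linarith)
  · rcases a1 with ⟨_, _⟩ | ⟨_, _⟩ <;> rcases h0 with ⟨_, _⟩ | ⟨_, _⟩ <;>
      rcases a4 with ⟨_, _⟩ | ⟨_, _⟩ <;> rcases a5 with ⟨_, _⟩ | ⟨_, _⟩ <;>
      first | (exfalso; linarith)
  · rcases a1 with ⟨_, _⟩ | ⟨_, _⟩ <;> rcases a2 with ⟨_, _⟩ | ⟨_, _⟩ <;>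
      rcases a4 with ⟨_, _⟩ | ⟨_, _⟩ <;> rcases a5 with ⟨_, _⟩ | ⟨_, _⟩ <;>
      first | (exfalso; linarith) |
      (refine R1 ⟨?_, ?_, ?_, ?_, ?_⟩ <;> linarith)
  · rcases a1 with ⟨_, _⟩ | ⟨_, _⟩ <;> rcases a2 with ⟨_, _⟩ | ⟨_, _⟩ <;>
      rcases h0 with ⟨_, _⟩ | ⟨_, _⟩ <;> rcases a5 with ⟨_, _⟩ | ⟨_, _⟩ <;>
      first | (exfalso; linarith) |
      (refine R10 ⟨?_, ?_, ?_, ?_, ?_⟩ <;> linarith) |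
      (refine R11 ⟨?_, ?_, ?_, ?_, ?_⟩ <;> linarith)
  · rcases a1 with ⟨_, _⟩ | ⟨_, _⟩ <;> rcases a2 with ⟨_, _⟩ | ⟨_, _⟩ <;>
      rcases a4 with ⟨_, _⟩ | ⟨_, _⟩ <;> rcases h0 with ⟨_, _⟩ | ⟨_, _⟩ <;>
      first | (exfalso; linarith)

/-! ### Weighted Laplacians of the hexagon as PPT states -/

/-- The first factors of the real product vectors `e (k + 1) - e k`, where `e 0, …, e 5` are the
standard basis vectors belonging to the vertices of the hexagon. -/
def hexLeft : Fin 6 → Fin 3 → ℝ :=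
  ![![1, 0, 0], ![-1, 1, 0], ![0, 1, 0], ![0, -1, 1], ![0, 0, 1], ![1, 0, -1]]

/-- The second factors of the real product vectors `e (k + 1) - e k`; see `hexLeft`. -/
def hexRight : Fin 6 → Fin 3 → ℝ :=
  ![![0, -1, 1], ![0, 0, 1], ![1, 0, -1], ![1, 0, 0], ![-1, 1, 0], ![0, 1, 0]]

/-- The Laplacian of the hexagon with edge weights `g`. -/
def hexState (g : Fin 6 → ℝ) : Matrix (Fin 3 × Fin 3) (Fin 3 × Fin 3) ℂ :=
  Matrix.of fun a b =>
    ∑ k, (g k : ℂ) * (hexLeft k a.1 * hexRight k a.2) * (hexLeft k b.1 * hexRight k b.2)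

/-- The Laplacian is a real combination of projections onto real product vectors. -/
theorem partialTranspose_hexState (g : Fin 6 → ℝ) :
    partialTranspose (hexState g) = hexState g := by
  ext a b
  simp only [partialTranspose, hexState, Matrix.of_apply]
  exact Finset.sum_congr rfl fun k _ => by ring

/-- The difference of the coordinates of a vector at the ends of the `k`-th edge. -/
def edgeDiff (x : Fin 3 × Fin 3 → ℂ) (k : Fin 6) : ℂ :=
  ∑ b, (hexLeft k b.1 * hexRight k b.2 : ℂ) * x b

theorem hexState_mulVec (g : Fin 6 → ℝ) (x : Fin 3 × Fin 3 → ℂ) (a : Fin 3 × Fin 3) :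
    (hexState g *ᵥ x) a = ∑ k, (hexLeft k a.1 * hexRight k a.2 : ℂ) * (g k * edgeDiff x k) := by
  simp only [Matrix.mulVec, dotProduct, hexState, Matrix.of_apply, Finset.sum_mul, edgeDiff,
    Finset.mul_sum]
  rw [Finset.sum_comm]
  exact Finset.sum_congr rfl fun k _ => Finset.sum_congr rfl fun b _ => by ring

theorem sum_hexLeft_mul_hexRight (a : Fin 3 × Fin 3) :
    ∑ k, (hexLeft k a.1 * hexRight k a.2 : ℂ) = 0 := by
  obtain ⟨i, j⟩ := a
  fin_cases i <;> fin_cases j <;> simp [hexLeft, hexRight, Fin.sum_univ_succ]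

theorem sum_edgeDiff (x : Fin 3 × Fin 3 → ℂ) : ∑ k, edgeDiff x k = 0 := by
  simp only [edgeDiff]
  rw [Finset.sum_comm]
  simp [← Finset.sum_mul, sum_hexLeft_mul_hexRight]

theorem star_dotProduct_hexState_mulVec (g : Fin 6 → ℝ) (x : Fin 3 × Fin 3 → ℂ) :
    star x ⬝ᵥ (hexState g *ᵥ x) = ((∑ k, g k * ‖edgeDiff x k‖ ^ 2 : ℝ) : ℂ) := by
  simp only [dotProduct, hexState_mulVec, Finset.mul_sum]
  rw [Finset.sum_comm]
  push_cast
  refine Finset.sum_congr rfl fun k _ => ?_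
  rw [← Complex.conj_mul']
  have : (starRingEnd ℂ) (edgeDiff x k) =
      ∑ a, star (x a) * (hexLeft k a.1 * hexRight k a.2 : ℂ) := by
    simp only [edgeDiff, map_sum, map_mul, Complex.conj_ofReal, Complex.star_def]
    exact Finset.sum_congr rfl fun _ _ => mul_comm _ _
  rw [this, Finset.sum_mul, Finset.mul_sum]
  exact Finset.sum_congr rfl fun a _ => by simp only [Pi.star_apply]; ring

/-- A series of resistances `a k` that add up to zero, all but one of them positive, dissipates a
nonnegative power: this is the Cauchy–Schwarz inequality. -/
theorem sum_inv_mul_norm_sq_nonneg {a : Fin 6 → ℝ} {m : Fin 6} (ha : ∀ k, k ≠ m → 0 < a k)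
    (hsum : ∑ k, a k = 0) {y : Fin 6 → ℂ} (hy : ∑ k, y k = 0) :
    0 ≤ ∑ k, (a k)⁻¹ * ‖y k‖ ^ 2 := by
  rw [← Finset.add_sum_erase _ _ (Finset.mem_univ m)] at hsum hy ⊢
  have h1 : ‖y m‖ ≤ ∑ k ∈ Finset.univ.erase m, ‖y k‖ := by
    rw [eq_neg_of_add_eq_zero_left hy, norm_neg]
    exact norm_sum_le _ _
  have h2 := Finset.sq_sum_div_le_sum_sq_div (Finset.univ.erase m) (fun k => ‖y k‖) (g := a)
    fun k hk => ha k (Finset.ne_of_mem_erase hk)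
  have h3 : 0 ≤ ∑ k ∈ Finset.univ.erase m, a k :=
    Finset.sum_nonneg fun k hk => (ha k (Finset.ne_of_mem_erase hk)).le
  have h4 : ‖y m‖ ^ 2 / ∑ k ∈ Finset.univ.erase m, a k ≤
      (∑ k ∈ Finset.univ.erase m, ‖y k‖) ^ 2 / ∑ k ∈ Finset.univ.erase m, a k := by
    gcongr
  rw [eq_neg_of_add_eq_zero_left hsum, inv_neg, neg_mul, neg_add_eq_sub, sub_nonneg,
    inv_mul_eq_div]
  refine h4.trans (h2.trans (le_of_eq (Finset.sum_congr rfl fun k _ => ?_)))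
  rw [inv_mul_eq_div]

theorem edgeDiff_stdVec_four (p q r s : ℝ) (k : Fin 6) :
    edgeDiff (fun ij => stdVec p q 4 ij.1 * stdVec r s 4 ij.2) k = hexDiff p q r s k := by
  fin_cases k <;>
    simp [edgeDiff, hexDiff, stdVec, hexLeft, hexRight, Fintype.sum_prod_type,
      Fin.sum_univ_three] <;> ring

theorem edgeDiff_stdVec_of_ne_four (p q r s : ℂ) (i : Fin 5) (hi : i ≠ 4) (k : Fin 6) :
    edgeDiff (fun ij => stdVec p q i ij.1 * stdVec r s i ij.2) k = 0 := by
  fin_cases i <;> fin_cases k <;>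
    simp [edgeDiff, stdVec, hexLeft, hexRight, Fintype.sum_prod_type, Fin.sum_univ_three] at hi ⊢

theorem four_le_rank_hexState {g : Fin 6 → ℝ} (hg : ∀ k, g k ≠ 0) : 4 ≤ (hexState g).rank := by
  set N : Matrix (Fin 4) (Fin 4) ℂ := (hexState g).submatrix ![((0 : Fin 3), (1 : Fin 3)), (0, 2), (1, 2), (1, 0)]
    ![((0 : Fin 3), (2 : Fin 3)), (1, 2), (1, 0), (2, 0)] with hN
  have hdet : N.det = ∏ i, N i i := by
    refine Matrix.det_of_isLowerTriangular _ ?_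
    intro i j hij
    replace hij : i < j := hij
    fin_cases i <;> fin_cases j <;>
      simp [hN, hexState, hexLeft, hexRight, Fin.sum_univ_six] at hij ⊢
  have hdiag : ∏ i, N i i = (g 0 * g 1 * g 2 * g 3 : ℝ) := by
    have h0 : N 0 0 = -g 0 := by
      change hexState g (0, 1) (0, 2) = _
      simp [hexState, hexLeft, hexRight, Fin.sum_univ_six]
    have h1 : N 1 1 = -g 1 := by
      change hexState g (0, 2) (1, 2) = _
      simp [hexState, hexLeft, hexRight, Fin.sum_univ_six]
    have h2 : N 2 2 = -g 2 := by
      change hexState g (1, 2) (1, 0) = _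
      simp [hexState, hexLeft, hexRight, Fin.sum_univ_six]
    have h3 : N 3 3 = -g 3 := by
      change hexState g (1, 0) (2, 0) = _
      simp [hexState, hexLeft, hexRight, Fin.sum_univ_six]
    rw [Fin.prod_univ_four, h0, h1, h2, h3]
    push_cast
    ring
  have hunit : IsUnit N := by
    rw [Matrix.isUnit_iff_isUnit_det, hdet, hdiag, isUnit_iff_ne_zero]
    exact_mod_cast mul_ne_zero (mul_ne_zero (mul_ne_zero (hg 0) (hg 1)) (hg 2)) (hg 3)
  calc 4 = N.rank := by rw [Matrix.rank_of_isUnit _ hunit, Fintype.card_fin]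
    _ ≤ _ := Matrix.rank_submatrix_le _ _ _

theorem linearIndependent_prodVec_stdVec {p q r s : ℂ} (hrs : r ≠ s) :
    LinearIndependent ℂ fun i => prodVec (stdVec p q i) (stdVec r s i) := by
  rw [Fintype.linearIndependent_iff]
  intro c hc
  have h := fun a b => congrFun (congrArg WithLp.ofLp hc) (a, b)
  have h01 := h 0 1
  have h02 := h 0 2
  have h00 := h 0 0
  have h11 := h 1 1
  have h22 := h 2 2
  simp [Fin.sum_univ_five, prodVec, stdVec] at h01 h02 h00 h11 h22
  have h4 : c 4 = 0 := by
    have : c 4 * (r - s) = 0 := by linear_combination h01 - h02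
    exact (mul_eq_zero.1 this).resolve_right (sub_ne_zero.2 hrs)
  have h3 : c 3 = 0 := by simpa [h4] using h01
  simp only [h3, h4, zero_mul, add_zero] at h00 h11 h22
  intro i
  fin_cases i <;> assumption

/-- If five of the differences along the hexagon have the same sign, the Laplacian with weights
`-1 / hexDiff` is a PPT state that annihilates the product vectors in normal form. -/
theorem hasPPTState_stdVec {p q r s : ℝ} {m : Fin 6} (h : ∀ k, k ≠ m → hexDiff p q r s k < 0)
    (hm : 0 < hexDiff p q r s m) (hrs : r ≠ s) :
    HasPPTState (stdVec p q) (stdVec r s) := by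
  set a : Fin 6 → ℝ := fun k => -hexDiff p q r s k with ha
  have hsum : ∑ k, a k = 0 := by
    simp [ha, hexDiff, Fin.sum_univ_succ]
    ring
  have ha0 : ∀ k, a k ≠ 0 := by
    intro k
    by_cases hk : k = m
    · exact hk ▸ (neg_neg_of_pos hm).ne
    · exact (neg_pos.2 (h k hk)).ne'
  have hker : ∀ i, prodVec (stdVec p q i) (stdVec r s i) ∈
      LinearMap.ker (Matrix.toEuclideanLin (hexState fun k => (a k)⁻¹)) := by
    intro i
    rw [mem_ker_toEuclideanLin_iff]
    ext b
    simp only [prodVec, hexState_mulVec, Pi.zero_apply]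
    by_cases hi : i = 4
    · subst hi
      rw [← neg_eq_zero, ← Finset.sum_neg_distrib, ← sum_hexLeft_mul_hexRight b]
      refine Finset.sum_congr rfl fun k _ => ?_
      have h1 : (((a k)⁻¹ : ℝ) : ℂ) * (hexDiff p q r s k : ℝ) = -1 := by
        have h2 : hexDiff p q r s k = -a k := by simp [ha]
        have h3 : (a k)⁻¹ * -a k = -1 := by rw [mul_neg, inv_mul_cancel₀ (ha0 k)]
        rw [h2, ← Complex.ofReal_mul, h3]
        simp
      rw [edgeDiff_stdVec_four, h1, mul_neg_one, neg_neg]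
    · simp [edgeDiff_stdVec_of_ne_four _ _ _ _ i hi]
  have hrank : (hexState fun k => (a k)⁻¹).rank = 4 := by
    refine le_antisymm ?_ (four_le_rank_hexState fun k => inv_ne_zero (ha0 k))
    have h5 := (linearIndependent_prodVec_stdVec (p := p) (q := q) (r := r) (s := s)
      (by exact_mod_cast hrs))
    have h6 := finrank_span_eq_card h5
    have h7 := Submodule.finrank_mono (Submodule.span_le.2 (Set.range_subset_iff.2 hker))
    have h8 := LinearMap.finrank_range_add_finrank_ker
      (Matrix.toEuclideanLin (hexState fun k => (a k)⁻¹))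
    rw [Matrix.rank_eq_finrank_range_toLin _ (EuclideanSpace.basisFun _ ℂ).toBasis
      (EuclideanSpace.basisFun _ ℂ).toBasis, ← Matrix.toEuclideanLin_eq_toLin_orthonormal]
    simp at h6 h8
    omega
  have hpsd : (hexState fun k => (a k)⁻¹).PosSemidef := by
    refine .of_dotProduct_mulVec_nonneg ?_ fun x => ?_
    · ext b c
      simp only [hexState, Matrix.conjTranspose_apply, Matrix.of_apply, star_sum, star_mul',
        Complex.star_def, Complex.conj_ofReal]
      exact Finset.sum_congr rfl fun k _ => by ring
    · rw [star_dotProduct_hexState_mulVec, Complex.zero_le_real]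
      exact sum_inv_mul_norm_sq_nonneg (m := m) (fun k hk => neg_pos.2 (h k hk)) hsum
        (sum_edgeDiff x)
  refine ⟨_, ⟨?_, hpsd, ?_⟩, hrank, hker⟩
  · intro h0
    simp [h0] at hrank
  · rwa [partialTranspose_hexState]

/-! ### The criterion -/

/-- Positive invariants belong to real parameters in the first sign region. -/
theorem exists_real_of_invariantTable_pos {p q r s : ℂ} (hr : r ≠ 1)
    (h : ∀ k, 0 < invariantTable p q r s 0 k) :
    ∃ p' q' r' s' : ℝ, p = p' ∧ q = q' ∧ r = r' ∧ s = s' ∧ signRegion p' q' r' s' 0 := by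
  have lift : ∀ z : ℂ, 0 < z → ∃ x : ℝ, z = x ∧ 0 < x := fun z hz => by
    obtain ⟨h1, h2⟩ := Complex.pos_iff.1 hz
    exact ⟨z.re, Complex.ext rfl (by simpa using h2.symm), h1⟩
  obtain ⟨x, hx, hx0⟩ := lift _ (h 0)
  obtain ⟨y, hy, hy0⟩ := lift _ (h 1)
  obtain ⟨z, hz, hz0⟩ := lift _ (h 2)
  obtain ⟨t, ht, ht0⟩ := lift _ (h 3)
  simp only [invariantTable, Matrix.cons_val] at hx hy hz ht
  have hq : q = ((y + 1 : ℝ) : ℂ) := by push_cast; linear_combination hy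
  have hq0 : q ≠ 0 := by
    rw [hq]; exact_mod_cast (by linarith : (y + 1 : ℝ) ≠ 0)
  have hs0 : s ≠ 0 := by
    rintro rfl
    rw [div_zero] at hz
    exact hz0.ne (by exact_mod_cast hz)
  have hp : p = ((-(x * (y + 1)) : ℝ) : ℂ) := by
    field_simp at hx
    rw [hq] at hx
    push_cast at hx ⊢
    linear_combination -hx
  have ht1 : ((1 + t : ℝ) : ℂ) ≠ 0 := by exact_mod_cast (by linarith : (1 + t : ℝ) ≠ 0)
  have hz1 : ((1 + z : ℝ) : ℂ) ≠ 0 := by exact_mod_cast (by linarith : (1 + z : ℝ) ≠ 0)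
  have hr' : r = ((t / (1 + t) : ℝ) : ℂ) := by
    rw [div_eq_iff (sub_ne_zero.2 hr.symm)] at ht
    rw [Complex.ofReal_div, eq_div_iff ht1]
    push_cast
    linear_combination ht
  have hs : s = ((t / (1 + t) / (1 + z) : ℝ) : ℂ) := by
    rw [div_eq_iff hs0] at hz
    rw [Complex.ofReal_div, eq_div_iff hz1, ← hr']
    push_cast
    linear_combination -hz
  have hr0 : 0 < t / (1 + t) := by positivity
  refine ⟨_, _, _, _, hp, hq, hr', hs, ?_, ?_, ?_, ?_, ?_⟩
  · have : 0 < x * (y + 1) := by positivity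
    linarith
  · linarith
  · positivity
  · exact div_lt_self hr0 (by linarith)
  · rw [div_lt_one (by linarith)]
    linarith

theorem perm_zero : perm 0 = 1 := by
  ext i
  fin_cases i <;> rfl

/-- After a relabelling of the product vectors, positive invariants mean that the parameters of the
normal form are real and that the differences along the hexagon are negative except for one. -/
theorem hasPPTState_of_permInvariants_pos {φ ψ : Fin 5 → EuclideanSpace ℂ (Fin 3)}
    (hφ : InGeneralPosition φ) (hψ : InGeneralPosition ψ) {κ : Equiv.Perm (Fin 5)}
    (h : ∀ k, 0 < permInvariants φ ψ κ k) : HasPPTState φ ψ := by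
  suffices H : HasPPTState (fun i => φ (κ i)) (fun i => ψ (κ i)) by
    obtain ⟨ρ, h1, h2, h3⟩ := H
    refine ⟨ρ, h1, h2, fun i => ?_⟩
    simpa using h3 (κ.symm i)
  obtain ⟨p, q, hpq⟩ := (hφ.comp_perm κ).exists_pslEquivalent_stdVec
  obtain ⟨r, s, hrs⟩ := (hψ.comp_perm κ).exists_pslEquivalent_stdVec
  have np := ne_of_inGeneralPosition_stdVec (hpq.inGeneralPosition (hφ.comp_perm κ))
  have nr := ne_of_inGeneralPosition_stdVec (hrs.inGeneralPosition (hψ.comp_perm κ))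
  have htab : ∀ k, 0 < invariantTable p q r s 0 k := by
    intro k
    rw [← permInvariants_stdVec np nr, ← permInvariants_eq_of_pslEquivalent hpq hrs, perm_zero]
    exact h k
  obtain ⟨p, q, r, s, rfl, rfl, rfl, rfl, hp, hq, hs, hsr, hr⟩ :=
    exists_real_of_invariantTable_pos nr.2.2.1 htab
  refine (hasPPTState_stdVec (m := 3) ?_ ?_ hsr.ne').of_pslEquivalent hpq hrs
  · intro k hk
    fin_cases k
    · exact sub_neg.2 hsr
    · exact mul_neg_of_pos_of_neg hs (by linarith)
    · exact mul_neg_of_neg_of_pos hp (by linarith)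
    · exact absurd rfl hk
    · exact mul_neg_of_pos_of_neg (by linarith) (by linarith)
    · exact mul_neg_of_pos_of_neg (by linarith) (by linarith)
  · change 0 < q - p
    linarith

theorem exists_perm_pos_of_hasPPTState {φ ψ : Fin 5 → EuclideanSpace ℂ (Fin 3)}
    (hφ : InGeneralPosition φ) (hψ : InGeneralPosition ψ) (h : HasPPTState φ ψ) :
    ∃ j : Fin 12, ∀ k, 0 < permInvariants φ ψ (perm j) k := by
  obtain ⟨p, q, hpq⟩ := hφ.exists_pslEquivalent_stdVec
  obtain ⟨r, s, hrs⟩ := hψ.exists_pslEquivalent_stdVec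
  have np := ne_of_inGeneralPosition_stdVec (hpq.inGeneralPosition hφ)
  have nr := ne_of_inGeneralPosition_stdVec (hrs.inGeneralPosition hψ)
  obtain ⟨ρ, hρ, -, hker⟩ := h.of_pslEquivalent hpq.symm hrs.symm
  obtain ⟨p', q', r', s', rfl, rfl, rfl, rfl, e, c, hc, hec, he⟩ :=
    exists_weights_of_isPPTState np nr hρ fun i => (mem_ker_toEuclideanLin_iff _ _).1 (hker i)
  obtain ⟨m, hm⟩ := exists_sign_pattern hc hec he
  obtain ⟨j, hj⟩ := exists_signRegion hm
  refine ⟨j, fun k => ?_⟩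
  rw [permInvariants_eq_of_pslEquivalent hpq hrs, permInvariants_stdVec np nr]
  exact invariantTable_pos_of_signRegion hj k

end GUPB

end

theorem mainTheorem3 (φ ψ : Fin 5 → EuclideanSpace ℂ (Fin 3)) (h : GUPB.IsGUPB φ ψ) :
    -- the criterion
    ((∃ ρ : Matrix (Fin 3 × Fin 3) (Fin 3 × Fin 3) ℂ,
        GUPB.IsPPTState ρ ∧ ρ.rank = 4 ∧
          ∀ i, GUPB.prodVec (φ i) (ψ i) ∈ LinearMap.ker (Matrix.toEuclideanLin ρ)) ↔
      ∃ κ : Equiv.Perm (Fin 5), ∀ k, 0 < GUPB.permInvariants φ ψ κ k) ∧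
    -- it suffices to check the twelve listed permutations
    ((∃ κ : Equiv.Perm (Fin 5), ∀ k, 0 < GUPB.permInvariants φ ψ κ k) ↔
      ∃ j : Fin 12, ∀ k, 0 < GUPB.permInvariants φ ψ (GUPB.perm j) k) ∧
    -- for them, the invariants are given by the table, in the parameters of the normal form
    (∃ p q r s : ℂ, GUPB.HasNormalForm φ ψ p q r s) ∧
    (∀ p q r s : ℂ, GUPB.HasNormalForm φ ψ p q r s →
      ∀ j k, GUPB.permInvariants φ ψ (GUPB.perm j) k = GUPB.invariantTable p q r s j k) := by
  have hφ := h.inGeneralPosition_left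
  have hψ := h.inGeneralPosition_right
  have state_to_perm := GUPB.exists_perm_pos_of_hasPPTState hφ hψ
  refine ⟨⟨fun hρ => ?_, fun ⟨κ, hκ⟩ => GUPB.hasPPTState_of_permInvariants_pos hφ hψ hκ⟩,
    ⟨fun ⟨κ, hκ⟩ => state_to_perm (GUPB.hasPPTState_of_permInvariants_pos hφ hψ hκ),
      fun ⟨j, hj⟩ => ⟨_, hj⟩⟩, ?_, ?_⟩
  · obtain ⟨j, hj⟩ := state_to_perm hρ
    exact ⟨_, hj⟩
  · obtain ⟨p, q, hpq⟩ := hφ.exists_pslEquivalent_stdVec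
    obtain ⟨r, s, hrs⟩ := hψ.exists_pslEquivalent_stdVec
    exact ⟨p, q, r, s, hpq, hrs⟩
  · rintro p q r s ⟨hpq, hrs⟩ j k
    rw [GUPB.permInvariants_eq_of_pslEquivalent hpq hrs, GUPB.permInvariants_stdVec
      (GUPB.ne_of_inGeneralPosition_stdVec (hpq.inGeneralPosition hφ))
      (GUPB.ne_of_inGeneralPosition_stdVec (hrs.inGeneralPosition hψ))]
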